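/- Let $1\le p<2$ and $q>0$. Let $\mathbf{B}$ be a real separable Banach space and let $X_1,X_2,\dots$ be independent $\mathbf{B}$-valued random variables on a probability space, each Bochner integrable with $\mathbb{E}(X_n)=0$. Put $S_n=X_1+\dots+X_n$. Suppose that $\{X_n,n\ge 1\}$ is stochastically dominated by a random variable $X$ with $\mathbb{E}(\|X\|^p)<\infty$, i.e. \[\sup_{n\ge 1}\mathbb{P}(\|X_n\|>t)\le \mathbb{P}(\|X\|>t)\quad\text{for all } t\ge 0,\] where $X$ takes values in a real separable Banach space (for instance $\mathbf{B}$ or $\mathbb{R}$) and may be defined on another probability space. If $0<q<1$, assume further that every $X_n$ is symmetric, i.e. $X_n$ and $-X_n$ have the same distribution. If \[\sum_{n=1}^{\infty}\frac1n\left(\frac{\|S_n\|}{n^{1/p}}\right)^q<\infty\quad\text{almost surely},\] then \[\lim_{n\to\infty}\frac{S_n}{n^{1/p}}=0\quad\text{almost surely}.\] -/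

import Mathlib

open MeasureTheory ProbabilityTheory Filter Topology

namespace PQSLLN

/-- The random variables `X 0, X 1, …` (that is, `X₁, X₂, …`) are stochastically dominated by `Y`:
`sup_n P(‖X_n‖ > t) ≤ P(‖Y‖ > t)` for every `t ≥ 0`. Only the law of `‖Y‖` matters, so `Y` may
live on another probability space and take values in another normed space. -/
def StochDominated {Ω Ω' B F : Type*} [MeasurableSpace Ω] [MeasurableSpace Ω']
    [NormedAddCommGroup B] [NormedAddCommGroup F]
    (X : ℕ → Ω → B) (μ : Measure Ω) (Y : Ω' → F) (ν : Measure Ω') : Prop :=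
  ∀ t : ℝ, 0 ≤ t → ⨆ n, μ {ω | t < ‖X n ω‖} ≤ ν {ω | t < ‖Y ω‖}

/-- `Z` is Bochner integrable with expectation zero. -/
def MeanZero {Ω B : Type*} [MeasurableSpace Ω] [NormedAddCommGroup B] [NormedSpace ℝ B]
    (Z : Ω → B) (μ : Measure Ω) : Prop :=
  Integrable Z μ ∧ ∫ ω, Z ω ∂μ = 0

/-- `Z` is symmetric: `Z` and `-Z` have the same law. -/
def SymmetricRV {Ω B : Type*} [MeasurableSpace Ω] [NormedAddCommGroup B] [MeasurableSpace B]
    (Z : Ω → B) (μ : Measure Ω) : Prop :=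
  IdentDistrib Z (fun ω => -Z ω) μ μ

/-- The sum of the first `n` variables; since `X i` stands for the `(i+1)`-st variable, this is
`S_n = X₁ + ⋯ + X_n`. -/
def partialSum {Ω B : Type*} [NormedAddCommGroup B] (X : ℕ → Ω → B) (n : ℕ) (ω : Ω) : B :=
  ∑ i ∈ Finset.range n, X i ω

/-- The `(p, q)`-type strong law: `∑_{n ≥ 1} (1/n) (‖S_n‖ / n^{1/p})^q < ∞` almost surely.
The index `n : ℕ` below stands for `n + 1 ≥ 1`. -/
def PQTypeSLLN {Ω B : Type*} [MeasurableSpace Ω] [NormedAddCommGroup B]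
    (p q : ℝ) (X : ℕ → Ω → B) (μ : Measure Ω) : Prop :=
  ∀ᵐ ω ∂μ, Summable fun n : ℕ =>
    1 / ((n + 1 : ℕ) : ℝ) *
      (‖partialSum X (n + 1) ω‖ / ((n + 1 : ℕ) : ℝ) ^ (1 / p)) ^ q

/-- The Marcinkiewicz–Zygmund strong law: `S_n / n^{1/p} → 0` in norm almost surely. -/
def MZSLLN {Ω B : Type*} [MeasurableSpace Ω] [NormedAddCommGroup B] [NormedSpace ℝ B]
    (p : ℝ) (X : ℕ → Ω → B) (μ : Measure Ω) : Prop :=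
  ∀ᵐ ω ∂μ, Tendsto (fun n : ℕ => ((n : ℝ) ^ (1 / p))⁻¹ • partialSum X n ω) atTop (𝓝 0)

end PQSLLN

/-! Fix the ratio `l = 2 ^ (1 / p)`, so that `l ^ k` is the normalisation at `2 ^ k`, and truncate
at `l ^ k` in the `k`-th dyadic range. A `1`-Lipschitz function of a sum of independent bounded
vectors has variance at most the sum of their second moments (`variance_lipschitz_sum_le`). Hence
the norm of a truncated sum concentrates around its mean in every Banach space, with no type
condition. The resulting bounds, like the probability that truncation alters a summand, are summable
in `k` because the `p`-th moment is finite (`sum_truncated_sq_le`). Doob's inequality and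
Borel–Cantelli then control all partial sums up to `2 ^ k`, provided that the mean norm of the
truncated sum is `o(l ^ k)`.

The series hypothesis supplies that proviso. It yields one index `n` in each late dyadic block at
which `‖S_n‖` is small with probability above one half (`eventually_exists_measureReal_lt_half`).
Concentration turns this into smallness of the mean norm at `n`, and monotonicity of mean norms of
centred sums (`integral_norm_sum_mono`) carries it down to `2 ^ k`. -/

namespace PQSLLN

/-! ### Concentration and maximal inequalities for sums of independent vectors -/

section IndependentSums

variable {Ω : Type*} [MeasurableSpace Ω] {μ : Measure Ω} [IsProbabilityMeasure μ]
  {B : Type*} [NormedAddCommGroup B] [MeasurableSpace B] [BorelSpace B]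

/-- The joint law is a product, so Fubini averages over `V` with `A` frozen. This stands in for
conditional expectation below. -/
theorem integral_indepFun_eq {α β : Type*} [MeasurableSpace α] [MeasurableSpace β]
    {A : Ω → α} {V : Ω → β} (hA : Measurable A) (hV : Measurable V) (hAV : IndepFun A V μ)
    {F : α × β → ℝ} (hF : Measurable F) (hint : Integrable (fun ω => F (A ω, V ω)) μ) :
    Integrable (fun ω => ∫ ω', F (A ω, V ω') ∂μ) μ ∧
    ∫ ω, F (A ω, V ω) ∂μ = ∫ ω, ∫ ω', F (A ω, V ω') ∂μ ∂μ := by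
  have hprod := (indepFun_iff_map_prod_eq_prod_map_map hA.aemeasurable hV.aemeasurable).1 hAV
  have hm : Measurable fun ω => (A ω, V ω) := hA.prodMk hV
  have := Measure.isProbabilityMeasure_map (μ := μ) hA.aemeasurable
  have := Measure.isProbabilityMeasure_map (μ := μ) hV.aemeasurable
  have hint' : Integrable F ((μ.map A).prod (μ.map V)) := by
    rw [← hprod, integrable_map_measure hF.aestronglyMeasurable hm.aemeasurable]
    exact hint
  have hinner : ∀ a, ∫ v, F (a, v) ∂(μ.map V) = ∫ ω', F (a, V ω') ∂μ := fun a =>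
    integral_map hV.aemeasurable (hF.comp measurable_prodMk_left).aestronglyMeasurable
  have hsm : StronglyMeasurable fun a => ∫ v, F (a, v) ∂(μ.map V) :=
    StronglyMeasurable.integral_prod_right (f := fun a v => F (a, v)) hF.stronglyMeasurable
  constructor
  · have h1 := hint'.integral_prod_left
    rw [integrable_map_measure hsm.aestronglyMeasurable hA.aemeasurable] at h1
    exact h1.congr (ae_of_all _ fun ω => hinner _)
  · calc ∫ ω, F (A ω, V ω) ∂μ = ∫ z, F z ∂(μ.map fun ω => (A ω, V ω)) :=
          (integral_map hm.aemeasurable hF.aestronglyMeasurable).symm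
      _ = ∫ a, ∫ v, F (a, v) ∂(μ.map V) ∂(μ.map A) := by rw [hprod, integral_prod _ hint']
      _ = ∫ ω, ∫ v, F (A ω, v) ∂(μ.map V) ∂μ :=
          integral_map hA.aemeasurable hsm.aestronglyMeasurable
      _ = _ := by simp_rw [hinner]

theorem memLp_comp_of_bounded {f : B → ℝ} (hf : LipschitzWith 1 f) {Z : Ω → B}
    (hZ : Measurable Z) {C : ℝ} (hC : ∀ ω, ‖Z ω‖ ≤ C) (r : ENNReal) :
    MemLp (fun ω => f (Z ω)) r μ := by
  refine MemLp.of_bound (hf.continuous.measurable.comp hZ).aestronglyMeasurable (|f 0| + C)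
    (ae_of_all _ fun ω => ?_)
  have h := hf.dist_le_mul (Z ω) 0
  rw [Real.dist_eq, dist_zero_right, NNReal.coe_one, one_mul] at h
  rw [Real.norm_eq_abs]
  have h2 : |f (Z ω)| ≤ |f (Z ω) - f 0| + |f 0| := by
    simpa using abs_add_le (f (Z ω) - f 0) (f 0)
  linarith [hC ω]

theorem variance_lipschitz_le {f : B → ℝ} (hf : LipschitzWith 1 f) {Z : Ω → B}
    (hZ : Measurable Z) {C : ℝ} (hC : ∀ ω, ‖Z ω‖ ≤ C) :
    Var[fun ω => f (Z ω); μ] ≤ ∫ ω, ‖Z ω‖ ^ 2 ∂μ := by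
  have hm : AEStronglyMeasurable (fun ω => f (Z ω)) μ :=
    (hf.continuous.measurable.comp hZ).aestronglyMeasurable
  rw [← variance_sub_const hm (f 0)]
  refine (variance_le_expectation_sq (hm.sub aestronglyMeasurable_const)).trans ?_
  refine integral_mono_of_nonneg (ae_of_all _ fun ω => sq_nonneg _) ?_ (ae_of_all _ fun ω => ?_)
  · refine Integrable.of_bound (hZ.norm.pow_const 2).aestronglyMeasurable (C ^ 2)
      (ae_of_all _ fun ω => ?_)
    rw [norm_pow, norm_norm]
    gcongr
    exact hC ω
  · have h := hf.dist_le_mul (Z ω) 0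
    rw [Real.dist_eq, dist_zero_right, NNReal.coe_one, one_mul] at h
    simpa [sq_abs] using pow_le_pow_left₀ (abs_nonneg _) h 2

theorem lipschitzWith_integral_add {B : Type*} [NormedAddCommGroup B] {f : B → ℝ}
    (hf : LipschitzWith 1 f) {Z : Ω → B} (hint : ∀ a, Integrable (fun ω => f (a + Z ω)) μ) :
    LipschitzWith 1 fun a => ∫ ω, f (a + Z ω) ∂μ := by
  refine LipschitzWith.of_le_add fun a b => ?_
  calc ∫ ω, f (a + Z ω) ∂μ ≤ ∫ ω, (f (b + Z ω) + dist a b) ∂μ := by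
        refine integral_mono (hint a) ((hint b).add (integrable_const _)) fun ω => ?_
        have h := hf.dist_le_mul (a + Z ω) (b + Z ω)
        rw [Real.dist_eq, dist_add_right, NNReal.coe_one, one_mul] at h
        linarith [le_abs_self (f (a + Z ω) - f (b + Z ω))]
    _ = _ := by
        rw [integral_add (hint b) (integrable_const _)]
        simp

/-- Law of total variance given `A`: the conditional variance is that of a `1`-Lipschitz function of
`V`, and the conditional mean is again a `1`-Lipschitz function of `A`, ready for induction. -/
theorem variance_add_le [SecondCountableTopology B] {f : B → ℝ} (hf : LipschitzWith 1 f)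
    {A V : Ω → B} (hA : Measurable A) (hV : Measurable V) {C D : ℝ} (hC : ∀ ω, ‖A ω‖ ≤ C)
    (hD : ∀ ω, ‖V ω‖ ≤ D) (hAV : IndepFun A V μ) :
    Var[fun ω => f (A ω + V ω); μ] ≤
      ∫ ω, ‖V ω‖ ^ 2 ∂μ + Var[fun ω => ∫ ω', f (A ω + V ω') ∂μ; μ] := by
  have hmem : MemLp (fun ω => f (A ω + V ω)) 2 μ :=
    memLp_comp_of_bounded hf (hA.add hV)
      (fun ω => (norm_add_le _ _).trans (add_le_add (hC ω) (hD ω))) 2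
  have hmema : ∀ a, MemLp (fun ω => f (a + V ω)) 2 μ := fun a =>
    memLp_comp_of_bounded hf (hV.const_add a)
      (fun ω => (norm_add_le _ _).trans (add_le_add_right (hD ω) _)) 2
  have hg := lipschitzWith_integral_add hf (fun a => (hmema a).integrable (by norm_num))
  have hmemg : MemLp (fun ω => ∫ ω', f (A ω + V ω') ∂μ) 2 μ := memLp_comp_of_bounded hg hA hC 2
  have hFm : Measurable fun z : B × B => f (z.1 + z.2) :=
    hf.continuous.measurable.comp (measurable_fst.add measurable_snd)
  have h1 := (integral_indepFun_eq hA hV hAV hFm (hmem.integrable (by norm_num))).2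
  obtain ⟨hi2, h2⟩ := integral_indepFun_eq hA hV hAV (hFm.pow_const 2) hmem.integrable_sq
  have hinner : ∀ a, ∫ ω', f (a + V ω') ^ 2 ∂μ ≤
      ∫ ω, ‖V ω‖ ^ 2 ∂μ + (∫ ω', f (a + V ω') ∂μ) ^ 2 := fun a => by
    have h3 := variance_lipschitz_le (μ := μ)
      (f := fun x => f (a + x)) (LipschitzWith.of_dist_le_mul
        fun x y => by simpa using hf.dist_le_mul (a + x) (a + y)) hV hD
    rw [variance_eq_sub (hmema a)] at h3
    simp only [Pi.pow_apply] at h3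
    linarith
  rw [variance_eq_sub hmem, variance_eq_sub hmemg]
  simp only [Pi.pow_apply] at *
  rw [h2, h1]
  have h4 : ∫ ω, ∫ ω', f (A ω + V ω') ^ 2 ∂μ ∂μ ≤
      ∫ ω, (∫ ω, ‖V ω‖ ^ 2 ∂μ + (∫ ω', f (A ω + V ω') ∂μ) ^ 2) ∂μ :=
    integral_mono hi2 ((integrable_const _).add hmemg.integrable_sq) fun ω => hinner _
  rw [integral_add (integrable_const _) hmemg.integrable_sq, integral_const] at h4
  simp only [probReal_univ, one_smul] at h4
  linarith

theorem norm_sum_range_le {Ω B : Type*} [NormedAddCommGroup B] {V : ℕ → Ω → B} {C : ℝ}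
    (hC : ∀ i ω, ‖V i ω‖ ≤ C) (n : ℕ) (ω : Ω) :
    ‖∑ i ∈ Finset.range n, V i ω‖ ≤ n * C := by
  simpa using norm_sum_le_of_le (Finset.range n) fun i _ => hC i ω

/-- A `1`-Lipschitz function of a sum of independent bounded vectors has variance at most the sum
of the second moments of the norms. -/
theorem variance_lipschitz_sum_le [SecondCountableTopology B] {V : ℕ → Ω → B}
    (hV : ∀ i, Measurable (V i)) {C : ℝ} (hC : ∀ i ω, ‖V i ω‖ ≤ C) (hind : iIndepFun V μ)
    (n : ℕ) : ∀ {f : B → ℝ}, LipschitzWith 1 f →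
    Var[fun ω => f (∑ i ∈ Finset.range n, V i ω); μ] ≤
      ∑ i ∈ Finset.range n, ∫ ω, ‖V i ω‖ ^ 2 ∂μ := by
  induction n with
  | zero =>
    intro f hf
    simp only [Finset.range_zero, Finset.sum_empty]
    exact (variance_lipschitz_le hf (Z := fun _ : Ω => (0 : B)) measurable_const (C := 0)
      (by simp)).trans (by simp)
  | succ n ih =>
    intro f hf
    have hA : Measurable fun ω => ∑ i ∈ Finset.range n, V i ω :=
      Finset.measurable_fun_sum _ fun i _ => hV i
    have hI : IndepFun (fun ω => ∑ i ∈ Finset.range n, V i ω) (V n) μ := by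
      have := hind.indepFun_finsetSum_of_notMem hV (s := Finset.range n) (i := n) (by simp)
      convert this using 1
      ext ω
      simp
    simp only [Finset.sum_range_succ]
    refine (variance_add_le hf hA (hV n) (norm_sum_range_le hC n) (hC n) hI).trans ?_
    -- The induction hypothesis is used for `f` averaged over the last summand, hence the quantifier
    -- over `f` inside the induction.
    have := ih (lipschitzWith_integral_add hf (Z := V n) (μ := μ) fun a =>
      (memLp_comp_of_bounded hf ((hV n).const_add a)
        (fun ω => (norm_add_le _ _).trans (add_le_add_right (hC n ω) _)) 1).integrable le_rfl)
    linarith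

/-- Jensen's inequality in the new centred increment, with the past frozen. -/
theorem submartingale_convex_sum [NormedSpace ℝ B] [CompleteSpace B] [SecondCountableTopology B]
    {V : ℕ → Ω → B} (hV : ∀ i, Measurable (V i)) {C : ℝ} (hC : ∀ i ω, ‖V i ω‖ ≤ C)
    (hind : iIndepFun V μ) (hmean : ∀ i, ∫ ω, V i ω ∂μ = 0) {g : B → ℝ} (hg : Continuous g)
    (hconv : ConvexOn ℝ Set.univ g) (hbdd : ∀ R : ℝ, ∃ K : ℝ, ∀ x, ‖x‖ ≤ R → |g x| ≤ K) :
    Submartingale (fun n ω => g (∑ i ∈ Finset.range (n + 1), V i ω))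
      (Filtration.natural V fun i => (hV i).stronglyMeasurable) μ := by
  have hint : ∀ {Z : Ω → B} {R : ℝ}, Measurable Z → (∀ ω, ‖Z ω‖ ≤ R) →
      Integrable (fun ω => g (Z ω)) μ := fun {Z R} hZ hR => by
    obtain ⟨K, hK⟩ := hbdd R
    exact Integrable.of_bound (hg.measurable.comp hZ).aestronglyMeasurable K
      (ae_of_all _ fun ω => hK _ (hR ω))
  have hS : ∀ n, Measurable fun ω => ∑ i ∈ Finset.range n, V i ω := fun n =>
    Finset.measurable_fun_sum _ fun i _ => hV i
  have hSad : ∀ n, Measurable[(Filtration.natural V fun i => (hV i).stronglyMeasurable) n]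
      fun ω => ∑ i ∈ Finset.range (n + 1), V i ω := fun n => by
    refine Finset.measurable_fun_sum _ fun i hi => ?_
    exact ((Filtration.stronglyAdapted_natural fun i => (hV i).stronglyMeasurable) i).measurable.mono
      (Filtration.mono _ (Nat.lt_succ_iff.1 (Finset.mem_range.1 hi))) le_rfl
  refine submartingale_of_setIntegral_le_succ
    (fun n => (hg.measurable.comp (hSad n)).stronglyMeasurable)
    (fun n => hint (hS _) (norm_sum_range_le hC _)) fun n s hs => ?_
  have hs' : MeasurableSet s := Filtration.le _ n s hs
  -- Pairing the indicator of the test event with the partial sum makes the relevant past one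
  -- variable, independent of the next increment.
  set A : Ω → ℝ × B := fun ω => (s.indicator (fun _ => 1) ω, ∑ i ∈ Finset.range (n + 1), V i ω)
    with hAdef
  have hAm : Measurable A := (measurable_const.indicator hs').prodMk (hS _)
  have hAad : Measurable[(Filtration.natural V fun i => (hV i).stronglyMeasurable) n] A :=
    (measurable_const.indicator hs).prodMk (hSad n)
  have hI : IndepFun A (V (n + 1)) μ := by
    rw [IndepFun_iff_Indep]
    exact indep_of_indep_of_le_left
      (hind.indep_comap_natural_of_lt (fun i => (hV i).stronglyMeasurable) n.lt_succ_self).symm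
      hAad.comap_le
  have hFm : Measurable fun z : (ℝ × B) × B => z.1.1 * g (z.1.2 + z.2) :=
    measurable_fst.fst.mul (hg.measurable.comp (measurable_fst.snd.add measurable_snd))
  have hind_mul : ∀ h : Ω → ℝ, (fun ω => s.indicator (fun _ => (1 : ℝ)) ω * h ω) = s.indicator h :=
    fun h => by ext ω; by_cases hω : ω ∈ s <;> simp [hω]
  have hFi : Integrable (fun ω => (A ω).1 * g ((A ω).2 + V (n + 1) ω)) μ := by
    have := (hint (hS (n + 2)) (norm_sum_range_le hC _)).indicator hs'
    rw [← hind_mul] at this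
    simpa only [hAdef, Finset.sum_range_succ _ (n + 1)] using this
  obtain ⟨hi, he⟩ := integral_indepFun_eq hAm (hV (n + 1)) hI hFm hFi
  rw [← integral_indicator hs', ← integral_indicator hs',
    ← hind_mul fun ω => g (∑ i ∈ Finset.range (n + 1), V i ω),
    ← hind_mul fun ω => g (∑ i ∈ Finset.range (n + 1 + 1), V i ω)]
  simp only [Finset.sum_range_succ _ (n + 1)]
  simp only [hAdef] at he hi
  rw [he]
  refine integral_mono ?_ hi fun ω => ?_
  · rw [hind_mul]
    exact (hint (hS (n + 1)) (norm_sum_range_le hC _)).indicator hs'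
  · simp only [integral_const_mul]
    refine mul_le_mul_of_nonneg_left ?_ (Set.indicator_nonneg (by simp) _)
    have hVi : Integrable (V (n + 1)) μ :=
      Integrable.of_bound (hV _).aestronglyMeasurable C (ae_of_all _ (hC _))
    set a := ∑ i ∈ Finset.range (n + 1), V i ω
    have := hconv.map_integral_le (f := fun ω' => a + V (n + 1) ω') (μ := μ) hg.continuousOn
      isClosed_univ (by simp) ((integrable_const a).add hVi)
      (hint ((hV _).const_add a) (R := ‖a‖ + C)
        fun ω => (norm_add_le _ _).trans (add_le_add_right (hC _ ω) _))
    rw [integral_add (integrable_const a) hVi, hmean] at this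
    simpa using this

theorem convexOn_sq_posPart_norm_sub {B : Type*} [NormedAddCommGroup B] [NormedSpace ℝ B] (a : ℝ) :
    ConvexOn ℝ Set.univ fun x : B => max (‖x‖ - a) 0 ^ 2 := by
  have h : ConvexOn ℝ Set.univ fun x : B => max (‖x‖ - a) 0 :=
    ((convexOn_norm convex_univ).sub (concaveOn_const a convex_univ)).sup
      (convexOn_const 0 convex_univ)
  exact h.pow (fun x _ => le_max_right _ _) 2

theorem integral_norm_sum_mono [NormedSpace ℝ B] [CompleteSpace B] [SecondCountableTopology B]
    {V : ℕ → Ω → B} (hV : ∀ i, Measurable (V i)) {C : ℝ} (hC : ∀ i ω, ‖V i ω‖ ≤ C)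
    (hind : iIndepFun V μ) (hmean : ∀ i, ∫ ω, V i ω ∂μ = 0) :
    Monotone fun n => ∫ ω, ‖∑ i ∈ Finset.range n, V i ω‖ ∂μ := by
  have h := submartingale_convex_sum hV hC hind hmean continuous_norm (convexOn_norm convex_univ)
    fun R => ⟨R, fun x hx => by simpa using hx⟩
  refine monotone_nat_of_le_succ fun n => ?_
  cases n with
  | zero => simpa using integral_nonneg fun ω => norm_nonneg _
  | succ n => simpa using h.setIntegral_le n.le_succ MeasurableSet.univ

/-- Doob's inequality for the excess of the norms of the partial sums over the expected norm of
the last one. -/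
theorem measure_exists_norm_sum_ge_le [NormedSpace ℝ B] [CompleteSpace B]
    [SecondCountableTopology B] {V : ℕ → Ω → B} (hV : ∀ i, Measurable (V i)) {C : ℝ}
    (hC : ∀ i ω, ‖V i ω‖ ≤ C) (hind : iIndepFun V μ) (hmean : ∀ i, ∫ ω, V i ω ∂μ = 0) (m : ℕ)
    {t : ℝ} (ht : 0 < t) :
    μ {ω | ∃ n ≤ m, ∫ ω, ‖∑ i ∈ Finset.range m, V i ω‖ ∂μ + t ≤ ‖∑ i ∈ Finset.range n, V i ω‖} ≤
      ENNReal.ofReal (Var[fun ω => ‖∑ i ∈ Finset.range m, V i ω‖; μ] / t ^ 2) := by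
  set a := ∫ ω, ‖∑ i ∈ Finset.range m, V i ω‖ ∂μ with ha
  have ha0 : 0 ≤ a := integral_nonneg fun ω => norm_nonneg _
  have hn0 : ∀ {ω n}, a + t ≤ ‖∑ i ∈ Finset.range n, V i ω‖ → n ≠ 0 := by
    rintro ω n h rfl
    simp at h
    linarith
  rcases Nat.eq_zero_or_pos m with hm | hm
  · have : {ω | ∃ n ≤ m, a + t ≤ ‖∑ i ∈ Finset.range n, V i ω‖} = ∅ := by
      ext ω
      simp only [Set.mem_ofPred_eq, Set.mem_empty_iff_false, iff_false]
      rintro ⟨n, hn, h⟩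
      exact hn0 h (by omega)
    simp [this]
  obtain ⟨m, rfl⟩ : ∃ k, m = k + 1 := ⟨m - 1, by omega⟩
  -- The squared positive part of `‖x‖ - a` is convex, and its mean at time `m` is at most the
  -- variance because `a` is the mean norm there.
  have hsub := submartingale_convex_sum hV hC hind hmean
    (g := fun x => max (‖x‖ - a) 0 ^ 2) (by fun_prop) (convexOn_sq_posPart_norm_sub a)
    fun R => ⟨|R| ^ 2, fun x hx => by
      rw [abs_of_nonneg (sq_nonneg _)]
      refine pow_le_pow_left₀ (le_max_right _ _) (max_le ?_ (abs_nonneg _)) 2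
      linarith [le_abs_self R]⟩
  have hmax := maximal_ineq hsub (fun n ω => sq_nonneg _) (ε := ⟨t ^ 2, sq_nonneg t⟩) m
  set E := {ω | ((⟨t ^ 2, sq_nonneg t⟩ : NNReal) : ℝ) ≤
    (Finset.range (m + 1)).sup' Finset.nonempty_range_add_one
      fun k => max (‖∑ i ∈ Finset.range (k + 1), V i ω‖ - a) 0 ^ 2}
  have hE : {ω | ∃ n ≤ m + 1, a + t ≤ ‖∑ i ∈ Finset.range n, V i ω‖} ⊆ E := by
    rintro ω ⟨n, hn, h⟩
    obtain ⟨k, rfl⟩ := Nat.exists_eq_succ_of_ne_zero (hn0 h)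
    have h1 : t ^ 2 ≤ max (‖∑ i ∈ Finset.range (k + 1), V i ω‖ - a) 0 ^ 2 :=
      pow_le_pow_left₀ ht.le (le_max_of_le_left (by linarith)) 2
    exact h1.trans (Finset.le_sup'
      (f := fun k => max (‖∑ i ∈ Finset.range (k + 1), V i ω‖ - a) 0 ^ 2)
      (Finset.mem_range.2 hn))
  have hS : Measurable fun ω => ∑ i ∈ Finset.range (m + 1), V i ω :=
    Finset.measurable_fun_sum _ fun i _ => hV i
  have hmem : MemLp (fun ω => ‖∑ i ∈ Finset.range (m + 1), V i ω‖) 2 μ :=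
    memLp_comp_of_bounded (f := fun x : B => ‖x‖) lipschitzWith_one_norm hS
      (norm_sum_range_le hC _) 2
  have hle : ∫ ω in E, max (‖∑ i ∈ Finset.range (m + 1), V i ω‖ - a) 0 ^ 2 ∂μ ≤
      Var[fun ω => ‖∑ i ∈ Finset.range (m + 1), V i ω‖; μ] := by
    rw [variance_eq_integral hmem.aestronglyMeasurable.aemeasurable]
    refine (setIntegral_le_integral (hsub.integrable m) (ae_of_all _ fun ω => sq_nonneg _)).trans ?_
    refine integral_mono (hsub.integrable m)
      ((hmem.sub (memLp_const a)).integrable_sq) fun ω => ?_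
    change max (_ - a) 0 ^ 2 ≤ (_ - a) ^ 2
    rcases le_total (‖∑ i ∈ Finset.range (m + 1), V i ω‖ - a) 0 with h | h
    · rw [max_eq_right h, zero_pow two_ne_zero]
      exact sq_nonneg _
    · rw [max_eq_left h]
  rw [ENNReal.ofReal_div_of_pos (by positivity), ENNReal.le_div_iff_mul_le
    (Or.inl (by simpa using ht.ne')) (Or.inl ENNReal.ofReal_ne_top), mul_comm]
  calc _ ≤ ENNReal.ofReal (t ^ 2) * μ E := by gcongr
    _ ≤ _ := by
      refine le_trans (le_of_eq ?_) (hmax.trans (ENNReal.ofReal_le_ofReal hle))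
      congr 1
      exact ENNReal.ofReal_eq_coe_nnreal (sq_nonneg t)

end IndependentSums

/-! ### Transfer of integrals under stochastic domination -/

section Domination

variable {Ω Ω' : Type*} [MeasurableSpace Ω] [MeasurableSpace Ω'] {μ : Measure Ω} {ν : Measure Ω'}

/-- Layer cake formula: `hlevel` makes each superlevel set of `φ` on the half-line empty or an open
ray, exactly the sets on which the tails are compared. -/
theorem lintegral_comp_le_of_tail_le {f : Ω → ℝ} {g : Ω' → ℝ} (hf : Measurable f)
    (hg : Measurable g) (hf0 : ∀ ω, 0 ≤ f ω) (hg0 : ∀ ω, 0 ≤ g ω)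
    (hfg : ∀ t, 0 ≤ t → μ {ω | t < f ω} ≤ ν {ω | t < g ω}) {φ : ℝ → ℝ} (hφ : Measurable φ)
    (hφ0 : ∀ x, 0 ≤ x → 0 ≤ φ x)
    (hlevel : ∀ t, 0 < t →
      (∃ s, 0 ≤ s ∧ ∀ x, 0 ≤ x → (t < φ x ↔ s < x)) ∨ ∀ x, 0 ≤ x → ¬ t < φ x) :
    ∫⁻ ω, ENNReal.ofReal (φ (f ω)) ∂μ ≤ ∫⁻ ω, ENNReal.ofReal (φ (g ω)) ∂ν := by
  rw [lintegral_eq_lintegral_meas_lt μ (ae_of_all _ fun ω => hφ0 _ (hf0 ω))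
      (hφ.comp hf).aemeasurable,
    lintegral_eq_lintegral_meas_lt ν (ae_of_all _ fun ω => hφ0 _ (hg0 ω)) (hφ.comp hg).aemeasurable]
  refine setLIntegral_mono' measurableSet_Ioi fun t ht => ?_
  rcases hlevel t ht with ⟨s, hs, h⟩ | h
  · simp only [h _ (hf0 _), h _ (hg0 _)]
    exact hfg s hs
  · simp [h _ (hf0 _)]

theorem integral_comp_le_of_tail_le {f : Ω → ℝ} {g : Ω' → ℝ} (hf : Measurable f)
    (hg : Measurable g) (hf0 : ∀ ω, 0 ≤ f ω) (hg0 : ∀ ω, 0 ≤ g ω)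
    (hfg : ∀ t, 0 ≤ t → μ {ω | t < f ω} ≤ ν {ω | t < g ω}) {φ : ℝ → ℝ} (hφ : Measurable φ)
    (hφ0 : ∀ x, 0 ≤ x → 0 ≤ φ x)
    (hlevel : ∀ t, 0 < t →
      (∃ s, 0 ≤ s ∧ ∀ x, 0 ≤ x → (t < φ x ↔ s < x)) ∨ ∀ x, 0 ≤ x → ¬ t < φ x)
    (hint : Integrable (fun ω => φ (g ω)) ν) :
    ∫ ω, φ (f ω) ∂μ ≤ ∫ ω, φ (g ω) ∂ν := by
  rw [integral_eq_lintegral_of_nonneg_ae (ae_of_all _ fun ω => hφ0 _ (hf0 ω))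
      (hφ.comp hf).aestronglyMeasurable,
    integral_eq_lintegral_of_nonneg_ae (ae_of_all _ fun ω => hφ0 _ (hg0 ω))
      (hφ.comp hg).aestronglyMeasurable]
  refine ENNReal.toReal_mono ?_ (lintegral_comp_le_of_tail_le hf hg hf0 hg0 hfg hφ hφ0 hlevel)
  exact ((hasFiniteIntegral_iff_ofReal (ae_of_all _ fun ω => hφ0 _ (hg0 ω))).1 hint.2).ne

/-- The part of a real number exceeding the level `L`. -/
noncomputable def tailPart (L x : ℝ) : ℝ := if L < x then x else 0

theorem measurable_tailPart (L : ℝ) : Measurable (tailPart L) :=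
  Measurable.ite measurableSet_Ioi measurable_id measurable_const

theorem tailPart_nonneg (L : ℝ) {x : ℝ} (hx : 0 ≤ x) : 0 ≤ tailPart L x := by
  unfold tailPart
  split_ifs <;> simp [hx]

theorem tailPart_le (L : ℝ) {x : ℝ} (hx : 0 ≤ x) : tailPart L x ≤ x := by
  unfold tailPart
  split_ifs <;> simp [hx]

theorem integral_min_sq_le_of_tail_le [IsFiniteMeasure ν] {f : Ω → ℝ} {g : Ω' → ℝ}
    (hf : Measurable f) (hg : Measurable g) (hf0 : ∀ ω, 0 ≤ f ω) (hg0 : ∀ ω, 0 ≤ g ω)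
    (hfg : ∀ t, 0 ≤ t → μ {ω | t < f ω} ≤ ν {ω | t < g ω}) {L : ℝ} (hL : 0 < L) :
    ∫ ω, min (f ω) L ^ 2 ∂μ ≤ ∫ ω, min (g ω) L ^ 2 ∂ν := by
  refine integral_comp_le_of_tail_le (φ := fun x => min x L ^ 2) hf hg hf0 hg0 hfg (by fun_prop)
    (fun x _ => sq_nonneg _) (fun t ht => ?_) ?_
  · have h : ∀ x, 0 ≤ x → (t < min x L ^ 2 ↔ √t < x ∧ √t < L) := fun x hx => by
      rw [← lt_min_iff, Real.sqrt_lt ht.le (le_min hx hL.le)]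
    by_cases hl : √t < L
    · exact Or.inl ⟨√t, Real.sqrt_nonneg _, fun x hx => by simp [h x hx, hl]⟩
    · exact Or.inr fun x hx => by simp [h x hx, hl]
  · refine Integrable.of_bound (C := L ^ 2) (by fun_prop) (ae_of_all _ fun ω => ?_)
    rw [Real.norm_eq_abs, abs_of_nonneg (sq_nonneg _)]
    exact pow_le_pow_left₀ (le_min (hg0 ω) hL.le) (min_le_right _ _) 2

theorem integral_tailPart_le_of_tail_le {f : Ω → ℝ} {g : Ω' → ℝ} (hf : Measurable f)
    (hg : Measurable g) (hf0 : ∀ ω, 0 ≤ f ω) (hg0 : ∀ ω, 0 ≤ g ω)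
    (hfg : ∀ t, 0 ≤ t → μ {ω | t < f ω} ≤ ν {ω | t < g ω}) (hint : Integrable g ν) {L : ℝ} :
    ∫ ω, tailPart L (f ω) ∂μ ≤ ∫ ω, tailPart L (g ω) ∂ν := by
  refine integral_comp_le_of_tail_le hf hg hf0 hg0 hfg (measurable_tailPart L)
    (fun x hx => tailPart_nonneg L hx) (fun t ht => Or.inl ⟨max t L, le_max_of_le_left ht.le,
      fun x hx => ?_⟩) ?_
  · unfold tailPart
    rw [max_lt_iff]
    split_ifs with h <;> simp [h, ht.le]
  · refine hint.mono ((measurable_tailPart L).comp hg).aestronglyMeasurable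
      (ae_of_all _ fun ω => ?_)
    rw [Real.norm_of_nonneg (tailPart_nonneg L (hg0 ω)), Real.norm_of_nonneg (hg0 ω)]
    exact tailPart_le L (hg0 ω)

end Domination

/-! ### Real series and limits at the scale `l ^ k` -/

section Series

variable {p l : ℝ}

theorem two_lt_sq_of_rpow_eq_two (hp2 : p < 2) (hl : 1 < l) (hlp : l ^ p = 2) :
    2 < l ^ 2 := by
  rw [← hlp, ← Real.rpow_natCast l 2]
  exact Real.rpow_lt_rpow_of_exponent_lt hl (by exact_mod_cast hp2)

theorem rpow_pow_eq_two_pow (hl : 1 < l) (hlp : l ^ p = 2) (k : ℕ) : (l ^ k) ^ p = 2 ^ k := by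
  rw [← hlp, ← Real.rpow_natCast l k, ← Real.rpow_natCast (l ^ p) k, ← Real.rpow_mul (by linarith),
    ← Real.rpow_mul (by linarith), mul_comm]

theorem sq_mul_le_rpow (hp2 : p < 2) (hp0 : 0 < p) (hl : 1 < l) (hlp : l ^ p = 2) {k : ℕ} {x : ℝ}
    (hx : 0 ≤ x) (hxk : x ≤ l ^ k) : x ^ 2 * (2 / l ^ 2) ^ k ≤ x ^ p := by
  rcases hx.eq_or_lt with rfl | hx
  · simp [Real.zero_rpow hp0.ne']
  have hlk : 0 < l ^ k := by positivity
  have h1 : x ^ (2 - p) ≤ (l ^ k) ^ (2 - p) := Real.rpow_le_rpow hx.le hxk (by linarith)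
  rw [Real.rpow_sub hx, Real.rpow_sub hlk, rpow_pow_eq_two_pow hl hlp, Real.rpow_two,
    Real.rpow_two, div_le_div_iff₀ (by positivity) (by positivity)] at h1
  rw [div_pow, ← mul_div_assoc, div_le_iff₀ (by positivity)]
  calc _ ≤ _ := h1
    _ = _ := by ring

/-- The terms equal `2 ^ k` while `l ^ k < x` and then decay with ratio `2 / l ^ 2 < 1`. Both
geometric pieces are comparable to `x ^ p` at the crossover. -/
theorem sum_truncated_sq_le (hp1 : 1 ≤ p) (hp2 : p < 2) (hl : 1 < l) (hlp : l ^ p = 2) {x : ℝ}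
    (hx : 0 ≤ x) (K : ℕ) :
    ∑ k ∈ Finset.range K, 2 ^ k * (min x (l ^ k) / l ^ k) ^ 2 ≤
      (2 + 1 / (1 - 2 / l ^ 2)) * x ^ p := by
  have hl2 := two_lt_sq_of_rpow_eq_two hp2 hl hlp
  set r := 2 / l ^ 2 with hr
  have hr0 : 0 < r := by positivity
  have hr1 : r < 1 := (div_lt_one (by positivity)).2 hl2
  have hxp : 0 ≤ x ^ p := Real.rpow_nonneg hx p
  -- The capped monotone sequences `u` and `h` bound the terms by telescoping differences, so the
  -- crossover index is never computed.
  set u : ℕ → ℝ := fun k => min (2 ^ k) (2 * x ^ p) with hu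
  set h : ℕ → ℝ := fun k => min (x ^ 2 * r ^ k) (x ^ p) with hh
  have hu_mono : ∀ k, u k ≤ u (k + 1) := fun k =>
    min_le_min (pow_le_pow_right₀ one_le_two k.le_succ) le_rfl
  have hh_anti : ∀ k, h (k + 1) ≤ h k := fun k =>
    min_le_min (mul_le_mul_of_nonneg_left
      (pow_le_pow_of_le_one hr0.le hr1.le k.le_succ) (sq_nonneg x)) le_rfl
  have hterm : ∀ k, 2 ^ k * (min x (l ^ k) / l ^ k) ^ 2 ≤
      (u (k + 1) - u k) + (h k - h (k + 1)) / (1 - r) := fun k => by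
    have hlk : 0 < l ^ k := by positivity
    rcases lt_or_ge (l ^ k) x with hk | hk
    · have h2 : (2 : ℝ) ^ k ≤ x ^ p := by
        rw [← rpow_pow_eq_two_pow hl hlp]
        exact Real.rpow_le_rpow hlk.le hk.le (by linarith)
      have e1 : u (k + 1) = 2 ^ (k + 1) := min_eq_left (by rw [pow_succ]; linarith)
      have e2 : u k = 2 ^ k := min_eq_left (by linarith)
      have : 0 ≤ (h k - h (k + 1)) / (1 - r) :=
        div_nonneg (by linarith [hh_anti k]) (by linarith)
      rw [min_eq_right hk.le, div_self hlk.ne', e1, e2, pow_succ (2 : ℝ) k]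
      linarith
    · have e1 : h k = x ^ 2 * r ^ k := min_eq_left (sq_mul_le_rpow hp2 (by linarith) hl hlp hx hk)
      have e2 : h (k + 1) ≤ x ^ 2 * r ^ (k + 1) := min_le_left _ _
      have e3 : x ^ 2 * r ^ k ≤ (h k - h (k + 1)) / (1 - r) := by
        rw [le_div_iff₀ (by linarith), e1]
        rw [pow_succ r] at e2
        linarith
      have e4 : 2 ^ k * (min x (l ^ k) / l ^ k) ^ 2 = x ^ 2 * r ^ k := by
        rw [min_eq_left hk, hr, div_pow, div_pow, ← pow_mul, ← pow_mul, mul_comm k 2]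
        ring
      linarith [hu_mono k]
  refine (Finset.sum_le_sum fun k _ => hterm k).trans ?_
  rw [Finset.sum_add_distrib, Finset.sum_range_sub, ← Finset.sum_div, Finset.sum_range_sub']
  have h1 : u K ≤ 2 * x ^ p := min_le_right _ _
  have h2 : 0 ≤ u 0 := by positivity
  have h3 : (h 0 - h K) / (1 - r) ≤ x ^ p / (1 - r) := by
    have : 0 ≤ h K := by positivity
    have : h 0 ≤ x ^ p := min_le_right _ _
    gcongr
    linarith
  calc _ ≤ 2 * x ^ p + x ^ p / (1 - r) := by linarith
    _ = _ := by ring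

variable {Ω : Type*} [MeasurableSpace Ω] {ν : Measure Ω} {f : Ω → ℝ}

theorem summable_integral_truncated_sq [IsFiniteMeasure ν] (hp1 : 1 ≤ p) (hp2 : p < 2) (hl : 1 < l)
    (hlp : l ^ p = 2) (hf : Measurable f) (hf0 : ∀ ω, 0 ≤ f ω)
    (hint : Integrable (fun ω => f ω ^ p) ν) :
    Summable fun k : ℕ => ∫ ω, 2 ^ k * (min (f ω) (l ^ k) / l ^ k) ^ 2 ∂ν := by
  have hi : ∀ k : ℕ, Integrable (fun ω => 2 ^ k * (min (f ω) (l ^ k) / l ^ k) ^ 2) ν := fun k => by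
    refine Integrable.of_bound (C := 2 ^ k * 1 ^ 2) (by fun_prop) (ae_of_all _ fun ω => ?_)
    have hlk : 0 < l ^ k := by positivity
    have h0 : 0 ≤ min (f ω) (l ^ k) := le_min (hf0 ω) hlk.le
    rw [Real.norm_of_nonneg (by positivity)]
    gcongr
    exact (div_le_one hlk).2 (min_le_right _ _)
  refine summable_of_sum_range_le (c := ∫ ω, (2 + 1 / (1 - 2 / l ^ 2)) * f ω ^ p ∂ν)
    (fun k => integral_nonneg fun ω => by positivity) fun K => ?_
  rw [← integral_finsetSum _ fun k _ => hi k]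
  exact integral_mono (integrable_finsetSum _ fun k _ => hi k) (hint.const_mul _)
    fun ω => sum_truncated_sq_le hp1 hp2 hl hlp (hf0 ω) K

theorem tailPart_mul_le_rpow (hp1 : 1 ≤ p) (hl : 1 < l) (hlp : l ^ p = 2) {x : ℝ} (hx : 0 ≤ x)
    (k : ℕ) : 2 ^ k / l ^ k * tailPart (l ^ k) x ≤ x ^ p := by
  have hlk : 0 < l ^ k := by positivity
  unfold tailPart
  split_ifs with h
  · have h1 : x / l ^ k ≤ (x / l ^ k) ^ p :=
      Real.self_le_rpow_of_one_le ((one_le_div hlk).2 h.le) hp1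
    rw [Real.div_rpow hx hlk.le, rpow_pow_eq_two_pow hl hlp, le_div_iff₀ (by positivity)] at h1
    calc _ = _ := by ring
      _ ≤ _ := h1
  · simpa using Real.rpow_nonneg hx p

/-- Dominated convergence under `f ^ p`. The quantity bounds the total drift caused by centring in a
block, relative to `l ^ k`. -/
theorem tendsto_integral_tailPart (hp1 : 1 ≤ p) (hl : 1 < l) (hlp : l ^ p = 2) (hf : Measurable f)
    (hf0 : ∀ ω, 0 ≤ f ω) (hint : Integrable (fun ω => f ω ^ p) ν) :
    Tendsto (fun k : ℕ => 2 ^ k / l ^ k * ∫ ω, tailPart (l ^ k) (f ω) ∂ν) atTop (𝓝 0) := by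
  simp_rw [← integral_const_mul]
  rw [← integral_zero Ω ℝ (μ := ν)]
  refine tendsto_integral_of_dominated_convergence (fun ω => f ω ^ p)
    (fun k => (((measurable_tailPart _).comp hf).const_mul _).aestronglyMeasurable) hint
    (fun k => ae_of_all _ fun ω => ?_) (ae_of_all _ fun ω => ?_)
  · have := tailPart_nonneg (l ^ k) (hf0 ω)
    rw [Real.norm_of_nonneg (by positivity)]
    exact tailPart_mul_le_rpow hp1 hl hlp (hf0 ω) k
  · refine tendsto_const_nhds.congr' ?_
    filter_upwards [(tendsto_pow_atTop_atTop_of_one_lt hl).eventually_ge_atTop (f ω)] with k hk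
    simp [tailPart, not_lt.2 hk]

end Series

/-! ### Truncation, centring and their error bounds -/

section Truncation

/-- The vector `x` if its norm is at most `L`, and zero otherwise. -/
noncomputable def truncNorm {B : Type*} [NormedAddCommGroup B] (L : ℝ) (x : B) : B :=
  if ‖x‖ ≤ L then x else 0

/-- The variables `X i` truncated at the level `L` and centred. -/
noncomputable def centredTrunc {Ω B : Type*} [MeasurableSpace Ω] [NormedAddCommGroup B]
    [NormedSpace ℝ B] (L : ℝ) (X : ℕ → Ω → B) (μ : Measure Ω) (i : ℕ) (ω : Ω) : B :=
  truncNorm L (X i ω) - ∫ ω, truncNorm L (X i ω) ∂μ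

theorem norm_truncNorm_le {B : Type*} [NormedAddCommGroup B] {L : ℝ} (hL : 0 ≤ L) (x : B) :
    ‖truncNorm L x‖ ≤ min ‖x‖ L := by
  unfold truncNorm
  split_ifs with h <;> simp [h, hL]

theorem norm_sub_truncNorm {B : Type*} [NormedAddCommGroup B] (L : ℝ) (x : B) :
    ‖x - truncNorm L x‖ = tailPart L ‖x‖ := by
  unfold truncNorm tailPart
  split_ifs with h h' h'
  · exact absurd h (not_le.2 h')
  · simp
  · simp
  · exact absurd (not_le.1 h) h'

variable {Ω Ω' : Type*} [MeasurableSpace Ω] [MeasurableSpace Ω'] {μ : Measure Ω}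
  [IsProbabilityMeasure μ] {ν : Measure Ω'} [IsProbabilityMeasure ν]
  {B : Type*} [NormedAddCommGroup B] [NormedSpace ℝ B] [CompleteSpace B]
  [SecondCountableTopology B] [MeasurableSpace B] [BorelSpace B]
  {X : ℕ → Ω → B} {g : Ω' → ℝ} {L : ℝ}

omit [NormedSpace ℝ B] [CompleteSpace B] [SecondCountableTopology B] in
theorem measurable_truncNorm (L : ℝ) : Measurable (truncNorm L : B → B) :=
  Measurable.ite (measurableSet_le measurable_norm measurable_const) measurable_id measurable_const

omit [NormedSpace ℝ B] [CompleteSpace B] in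
theorem integrable_truncNorm (hX : ∀ i, Measurable (X i)) (hL : 0 ≤ L) (i : ℕ) :
    Integrable (fun ω => truncNorm L (X i ω)) μ :=
  Integrable.of_bound ((measurable_truncNorm L).comp (hX i)).aestronglyMeasurable L
    (ae_of_all _ fun _ => (norm_truncNorm_le hL _).trans (min_le_right _ _))

omit [IsProbabilityMeasure μ] [CompleteSpace B] [SecondCountableTopology B] in
theorem measurable_centredTrunc (hX : ∀ i, Measurable (X i)) (i : ℕ) :
    Measurable (centredTrunc L X μ i) :=
  ((measurable_truncNorm L).comp (hX i)).sub_const _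

omit [CompleteSpace B] [SecondCountableTopology B] [MeasurableSpace B] [BorelSpace B] in
theorem norm_centredTrunc_le (hL : 0 ≤ L) (i : ℕ) (ω : Ω) : ‖centredTrunc L X μ i ω‖ ≤ L + L := by
  have h : ∀ ω, ‖truncNorm L (X i ω)‖ ≤ L := fun ω =>
    (norm_truncNorm_le hL _).trans (min_le_right _ _)
  refine (norm_sub_le _ _).trans (add_le_add (h ω) ?_)
  simpa using norm_integral_le_of_norm_le_const (μ := μ) (ae_of_all _ h)

theorem integral_centredTrunc (hX : ∀ i, Measurable (X i)) (hL : 0 ≤ L) (i : ℕ) :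
    ∫ ω, centredTrunc L X μ i ω ∂μ = 0 := by
  unfold centredTrunc
  rw [integral_sub (integrable_truncNorm hX hL i) (integrable_const _)]
  simp

omit [IsProbabilityMeasure μ] [CompleteSpace B] [SecondCountableTopology B] in
theorem iIndepFun_centredTrunc (hind : iIndepFun X μ) : iIndepFun (centredTrunc L X μ) μ :=
  hind.comp (fun i x => truncNorm L x - ∫ ω, truncNorm L (X i ω) ∂μ)
    fun _ => (measurable_truncNorm L).sub_const _

-- The centring is absorbed into the Lipschitz function as a shift of the norm, so only uncentred
-- second moments appear. They are bounded through `min`, which is monotone and so respects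
-- domination, unlike truncation to zero.
omit [CompleteSpace B] in
theorem variance_norm_sum_centredTrunc_le (hX : ∀ i, Measurable (X i)) (hind : iIndepFun X μ)
    (hg : Measurable g) (hg0 : ∀ ω, 0 ≤ g ω)
    (htail : ∀ i t, 0 ≤ t → μ {ω | t < ‖X i ω‖} ≤ ν {ω | t < g ω}) (hL : 0 < L) (n : ℕ) :
    Var[fun ω => ‖∑ i ∈ Finset.range n, centredTrunc L X μ i ω‖; μ] ≤
      n * (L ^ 2 * ∫ ω, (min (g ω) L / L) ^ 2 ∂ν) := by
  have hT : ∀ i ω, ‖truncNorm L (X i ω)‖ ≤ min ‖X i ω‖ L := fun i ω => norm_truncNorm_le hL.le _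
  have hlip : LipschitzWith 1 fun x : B =>
      ‖x - ∑ i ∈ Finset.range n, ∫ ω, truncNorm L (X i ω) ∂μ‖ :=
    LipschitzWith.of_dist_le_mul fun x y => by
      rw [Real.dist_eq, NNReal.coe_one, one_mul, dist_eq_norm]
      simpa using abs_norm_sub_norm_le (x - ∑ i ∈ Finset.range n, ∫ ω, truncNorm L (X i ω) ∂μ)
        (y - ∑ i ∈ Finset.range n, ∫ ω, truncNorm L (X i ω) ∂μ)
  have h := variance_lipschitz_sum_le (V := fun i ω => truncNorm L (X i ω))
    (fun i => (measurable_truncNorm L).comp (hX i))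
    (fun i ω => (hT i ω).trans (min_le_right _ _))
    (hind.comp (fun _ => truncNorm L) fun _ => measurable_truncNorm L) n hlip
  simp only [centredTrunc, Finset.sum_sub_distrib]
  refine h.trans ?_
  have hterm : ∀ i, ∫ ω, ‖truncNorm L (X i ω)‖ ^ 2 ∂μ ≤
      L ^ 2 * ∫ ω, (min (g ω) L / L) ^ 2 ∂ν := fun i => by
    rw [← integral_const_mul]
    have e : (fun ω => L ^ 2 * (min (g ω) L / L) ^ 2) = fun ω => min (g ω) L ^ 2 := by
      ext ω
      rw [div_pow]
      field_simp
    rw [e]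
    refine le_trans ?_ (integral_min_sq_le_of_tail_le (hX i).norm hg (fun ω => norm_nonneg _) hg0
      (htail i) hL)
    refine integral_mono_of_nonneg (ae_of_all _ fun ω => sq_nonneg _) ?_
      (ae_of_all _ fun ω => pow_le_pow_left₀ (norm_nonneg _) (hT i ω) 2)
    refine Integrable.of_bound (C := L ^ 2)
      (((hX i).norm.min measurable_const).pow_const 2).aestronglyMeasurable
      (ae_of_all _ fun ω => ?_)
    rw [Real.norm_of_nonneg (sq_nonneg _)]
    exact pow_le_pow_left₀ (le_min (norm_nonneg _) hL.le) (min_le_right _ _) 2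
  simpa using Finset.sum_le_card_nsmul (Finset.range n) _ _ fun i _ => hterm i

-- Since `X i` has mean zero, the mean of its truncation is minus the mean of the discarded part.
omit [IsProbabilityMeasure ν] [CompleteSpace B] in
theorem norm_integral_truncNorm_le (hX : ∀ i, Measurable (X i)) (hmean : ∀ i, MeanZero (X i) μ)
    (hg : Measurable g) (hg0 : ∀ ω, 0 ≤ g ω) (hgi : Integrable g ν)
    (htail : ∀ i t, 0 ≤ t → μ {ω | t < ‖X i ω‖} ≤ ν {ω | t < g ω}) (hL : 0 ≤ L) (i : ℕ) :
    ‖∫ ω, truncNorm L (X i ω) ∂μ‖ ≤ ∫ ω, tailPart L (g ω) ∂ν := by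
  calc ‖∫ ω, truncNorm L (X i ω) ∂μ‖ = ‖∫ ω, (X i ω - truncNorm L (X i ω)) ∂μ‖ := by
        rw [integral_sub (hmean i).1 (integrable_truncNorm hX hL i), (hmean i).2, zero_sub,
          norm_neg]
    _ ≤ ∫ ω, ‖X i ω - truncNorm L (X i ω)‖ ∂μ := norm_integral_le_integral_norm _
    _ = ∫ ω, tailPart L ‖X i ω‖ ∂μ := by simp_rw [norm_sub_truncNorm]
    _ ≤ _ := integral_tailPart_le_of_tail_le (hX i).norm hg (fun ω => norm_nonneg _) hg0
        (htail i) hgi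

omit [IsProbabilityMeasure ν] [CompleteSpace B] in
theorem norm_partialSum_sub_le (hX : ∀ i, Measurable (X i)) (hmean : ∀ i, MeanZero (X i) μ)
    (hg : Measurable g) (hg0 : ∀ ω, 0 ≤ g ω) (hgi : Integrable g ν)
    (htail : ∀ i t, 0 ≤ t → μ {ω | t < ‖X i ω‖} ≤ ν {ω | t < g ω}) (hL : 0 ≤ L) {m n : ℕ}
    (hnm : n ≤ m) {ω : Ω} (hω : ¬ ∃ i < m, L < ‖X i ω‖) :
    ‖partialSum X n ω - ∑ i ∈ Finset.range n, centredTrunc L X μ i ω‖ ≤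
      m * ∫ ω, tailPart L (g ω) ∂ν := by
  push Not at hω
  have hD : 0 ≤ ∫ ω, tailPart L (g ω) ∂ν := integral_nonneg fun ω => tailPart_nonneg L (hg0 ω)
  unfold partialSum
  rw [← Finset.sum_sub_distrib]
  have h : ∀ i ∈ Finset.range n, ‖X i ω - centredTrunc L X μ i ω‖ ≤ ∫ ω, tailPart L (g ω) ∂ν :=
    fun i hi => by
      have : truncNorm L (X i ω) = X i ω :=
        if_pos (hω i ((Finset.mem_range.1 hi).trans_le hnm))
      rw [centredTrunc, this, sub_sub_cancel]
      exact norm_integral_truncNorm_le hX hmean hg hg0 hgi htail hL i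
  calc _ ≤ n * ∫ ω, tailPart L (g ω) ∂ν := by simpa using norm_sum_le_of_le _ h
    _ ≤ _ := by gcongr

-- A union bound, stated with the integral from the variance estimate so that one summable series
-- controls both.
omit [IsProbabilityMeasure μ] [NormedSpace ℝ B] [CompleteSpace B] [SecondCountableTopology B]
  [MeasurableSpace B] [BorelSpace B] in
theorem measureReal_exists_norm_gt_le (hg : Measurable g) (hg0 : ∀ ω, 0 ≤ g ω)
    (htail : ∀ i t, 0 ≤ t → μ {ω | t < ‖X i ω‖} ≤ ν {ω | t < g ω}) (hL : 0 < L) (m : ℕ) :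
    μ.real {ω | ∃ i < m, L < ‖X i ω‖} ≤ m * ∫ ω, (min (g ω) L / L) ^ 2 ∂ν := by
  have hν : ν.real {ω | L < g ω} ≤ ∫ ω, (min (g ω) L / L) ^ 2 ∂ν := by
    have hi : Integrable (fun ω => (min (g ω) L / L) ^ 2) ν := by
      refine Integrable.of_bound (C := 1 ^ 2) (by fun_prop) (ae_of_all _ fun ω => ?_)
      have h0 : 0 ≤ min (g ω) L := le_min (hg0 ω) hL.le
      rw [Real.norm_of_nonneg (sq_nonneg _)]
      gcongr
      exact (div_le_one hL).2 (min_le_right _ _)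
    rw [← integral_indicator_one (measurableSet_lt measurable_const hg)]
    refine integral_mono_of_nonneg (ae_of_all _ fun ω => Set.indicator_nonneg (by simp) _) hi
      (ae_of_all _ fun ω => ?_)
    by_cases hω : L < g ω
    · simp [hω, min_eq_right hω.le, div_self hL.ne']
    · simp [hω, sq_nonneg]
  have hset : {ω | ∃ i < m, L < ‖X i ω‖} = ⋃ i ∈ Finset.range m, {ω | L < ‖X i ω‖} := by
    ext ω
    simp
  rw [hset]
  refine (measureReal_biUnion_finset_le _ _).trans ?_
  have := Finset.sum_le_card_nsmul (Finset.range m) (fun i => μ.real {ω | L < ‖X i ω‖})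
    (∫ ω, (min (g ω) L / L) ^ 2 ∂ν) fun i _ =>
      (ENNReal.toReal_mono (measure_ne_top _ _) (htail i L hL.le)).trans hν
  simpa using this

end Truncation

/-! ### Extracting good indices from the series hypothesis -/

section Blocks

variable {Ω : Type*} [MeasurableSpace Ω] {μ : Measure Ω} [IsProbabilityMeasure μ]

theorem tendsto_sum_Ico_two_pow {f : ℕ → ℝ} (hf : Summable f) :
    Tendsto (fun k => ∑ n ∈ Finset.Ico (2 ^ k) (2 ^ (k + 1)), f n) atTop (𝓝 0) := by
  have h : Tendsto (fun k : ℕ => ∑ n ∈ Finset.range (2 ^ k), f n) atTop (𝓝 (∑' n, f n)) :=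
    hf.hasSum.tendsto_sum_nat.comp (tendsto_pow_atTop_atTop_of_one_lt one_lt_two)
  have h' := ((tendsto_add_atTop_iff_nat 1).2 h).sub h
  rw [sub_self] at h'
  refine h'.congr fun k => ?_
  rw [Finset.sum_Ico_eq_sub _ (Nat.pow_le_pow_right two_pos k.le_succ)]

/-- Each bad index in the block contributes at least `c ^ q / (2 * 2 ^ k)` to the series, so the
proportion of bad indices is bounded by a multiple of the block sum. -/
theorem tendsto_block_average {p q c : ℝ} (hq : 0 < q) (hc : 0 < c) {u : ℕ → ℝ}
    (hu : ∀ n, 0 ≤ u n)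
    (hsum : Summable fun n : ℕ =>
      1 / ((n + 1 : ℕ) : ℝ) * (u (n + 1) / ((n + 1 : ℕ) : ℝ) ^ (1 / p)) ^ q) :
    Tendsto (fun k => ((2 : ℝ) ^ k)⁻¹ * ∑ n ∈ Finset.Ico (2 ^ k) (2 ^ (k + 1)),
      {n : ℕ | c * (n : ℝ) ^ (1 / p) ≤ u n}.indicator (fun _ => (1 : ℝ)) n) atTop (𝓝 0) := by
  have hs : Summable fun n : ℕ => 1 / (n : ℝ) * (u n / (n : ℝ) ^ (1 / p)) ^ q :=
    (summable_nat_add_iff 1).1 hsum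
  have h := (tendsto_sum_Ico_two_pow hs).const_mul (2 / c ^ q)
  rw [mul_zero] at h
  refine squeeze_zero (fun k => ?_) (fun k => ?_) h
  · exact mul_nonneg (by positivity)
      (Finset.sum_nonneg fun n _ => Set.indicator_nonneg (by simp) _)
  rw [Finset.mul_sum, Finset.mul_sum]
  refine Finset.sum_le_sum fun n hn => ?_
  obtain ⟨hn1, hn2⟩ := Finset.mem_Ico.1 hn
  have hn0 : 0 < (n : ℝ) := by
    have : 0 < n := lt_of_lt_of_le (by positivity) hn1
    exact_mod_cast this
  have hnp : 0 < (n : ℝ) ^ (1 / p) := Real.rpow_pos_of_pos hn0 _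
  have hcq : 0 < c ^ q := Real.rpow_pos_of_pos hc q
  by_cases hin : c * (n : ℝ) ^ (1 / p) ≤ u n
  · rw [Set.indicator_of_mem (show n ∈ {n : ℕ | c * (n : ℝ) ^ (1 / p) ≤ u n} from hin), mul_one]
    have h1 : c ^ q ≤ (u n / (n : ℝ) ^ (1 / p)) ^ q :=
      Real.rpow_le_rpow hc.le ((le_div_iff₀ hnp).2 hin) hq.le
    have h2 : ((2 : ℝ) ^ k)⁻¹ ≤ 2 * (1 / n) := by
      rw [inv_eq_one_div, mul_one_div, div_le_div_iff₀ (by positivity) hn0, one_mul]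
      have : (n : ℝ) ≤ 2 ^ (k + 1) := by exact_mod_cast hn2.le
      rw [pow_succ] at this
      linarith
    calc ((2 : ℝ) ^ k)⁻¹ ≤ 2 * (1 / n) := h2
      _ = 2 / c ^ q * (1 / n * c ^ q) := by field_simp
      _ ≤ _ := by gcongr
  · rw [Set.indicator_of_notMem (show n ∉ {n : ℕ | c * (n : ℝ) ^ (1 / p) ≤ u n} from hin), mul_zero]
    have := hu n
    positivity

/-- If the weighted series converges almost surely, every late dyadic block contains an index at
which the normalised variable is small with probability more than one half. -/
theorem eventually_exists_measureReal_lt_half {p q c : ℝ} (hq : 0 < q) (hc : 0 < c)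
    {u : ℕ → Ω → ℝ} (hum : ∀ n, Measurable (u n)) (hu : ∀ n ω, 0 ≤ u n ω)
    (hsum : ∀ᵐ ω ∂μ, Summable fun n : ℕ =>
      1 / ((n + 1 : ℕ) : ℝ) * (u (n + 1) ω / ((n + 1 : ℕ) : ℝ) ^ (1 / p)) ^ q) :
    ∀ᶠ k in atTop, ∃ n ∈ Finset.Ico (2 ^ k : ℕ) (2 ^ (k + 1)),
      μ.real {ω | c * (n : ℝ) ^ (1 / p) ≤ u n ω} < 1 / 2 := by
  have hms : ∀ n : ℕ, MeasurableSet {ω | c * (n : ℝ) ^ (1 / p) ≤ u n ω} := fun n =>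
    measurableSet_le measurable_const (hum n)
  set G : ℕ → Ω → ℝ := fun k ω => ((2 : ℝ) ^ k)⁻¹ * ∑ n ∈ Finset.Ico (2 ^ k : ℕ) (2 ^ (k + 1)),
    {ω | c * (n : ℝ) ^ (1 / p) ≤ u n ω}.indicator (fun _ => (1 : ℝ)) ω with hG
  have hcard : ∀ k : ℕ, (Finset.Ico (2 ^ k : ℕ) (2 ^ (k + 1))).card = 2 ^ k := fun k => by
    rw [Nat.card_Ico, pow_succ]
    omega
  -- `G k` is the proportion of bad indices in block `k`; its mean would be at least one half if
  -- every index were bad with that probability.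
  have hlim : Tendsto (fun k => ∫ ω, G k ω ∂μ) atTop (𝓝 (∫ _, (0 : ℝ) ∂μ)) := by
    refine tendsto_integral_of_dominated_convergence (fun _ => 1) (fun k => ?_)
      (integrable_const _) (fun k => ae_of_all _ fun ω => ?_) ?_
    · exact ((Finset.measurable_fun_sum _ fun n _ =>
        measurable_const.indicator (hms n)).const_mul _).aestronglyMeasurable
    · rw [Real.norm_of_nonneg (mul_nonneg (by positivity)
        (Finset.sum_nonneg fun n _ => Set.indicator_nonneg (by simp) _))]
      rw [inv_mul_le_iff₀ (by positivity), mul_one]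
      have := Finset.sum_le_card_nsmul (Finset.Ico (2 ^ k : ℕ) (2 ^ (k + 1)))
        (fun n => {ω | c * (n : ℝ) ^ (1 / p) ≤ u n ω}.indicator (fun _ => (1 : ℝ)) ω) 1
        fun n _ => Set.indicator_apply_le' (fun _ => le_rfl) (fun _ => zero_le_one)
      rw [hcard] at this
      simpa using this
    · filter_upwards [hsum] with ω hω
      exact tendsto_block_average hq hc (fun n => hu n ω) hω
  rw [integral_zero] at hlim
  filter_upwards [hlim.eventually_lt_const (show (0 : ℝ) < 1 / 2 by norm_num)] with k hk
  by_contra! hcon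
  have hint : ∫ ω, G k ω ∂μ = ((2 : ℝ) ^ k)⁻¹ * ∑ n ∈ Finset.Ico (2 ^ k : ℕ) (2 ^ (k + 1)),
      μ.real {ω | c * (n : ℝ) ^ (1 / p) ≤ u n ω} := by
    rw [hG, integral_const_mul, integral_finsetSum _ fun n _ =>
      (integrable_const (1 : ℝ)).indicator (hms n)]
    simp_rw [integral_indicator_const _ (hms _), smul_eq_mul, mul_one]
  have := Finset.card_nsmul_le_sum _ _ _ hcon
  rw [hcard, nsmul_eq_mul] at this
  push_cast at this
  rw [hint, inv_mul_lt_iff₀ (by positivity)] at hk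
  linarith

end Blocks

/-! ### Assembling the strong law -/

section StrongLaw

variable {Ω Ω' : Type*} [MeasurableSpace Ω] [MeasurableSpace Ω'] {μ : Measure Ω}
  [IsProbabilityMeasure μ] {ν : Measure Ω'} [IsProbabilityMeasure ν]
  {B : Type*} [NormedAddCommGroup B] [NormedSpace ℝ B] [CompleteSpace B]
  [SecondCountableTopology B] [MeasurableSpace B] [BorelSpace B]
  {X : ℕ → Ω → B} {g : Ω' → ℝ} {p q l : ℝ}

theorem rpow_one_div_pow (hp0 : 0 < p) (hl : 1 < l) (hlp : l ^ p = 2) (k : ℕ) :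
    ((2 : ℝ) ^ k) ^ (1 / p) = l ^ k := by
  rw [← rpow_pow_eq_two_pow hl hlp, ← Real.rpow_mul (by positivity), mul_one_div_cancel hp0.ne',
    Real.rpow_one]

theorem le_two_of_rpow_eq_two (hp1 : 1 ≤ p) (hl : 1 < l) (hlp : l ^ p = 2) : l ≤ 2 :=
  (Real.self_le_rpow_of_one_le hl.le hp1).trans hlp.le

theorem integrable_of_integrable_rpow (hp1 : 1 ≤ p) (hg : Measurable g) (hg0 : ∀ ω, 0 ≤ g ω)
    (hint : Integrable (fun ω => g ω ^ p) ν) : Integrable g ν := by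
  refine ((integrable_const (1 : ℝ)).add hint).mono' hg.aestronglyMeasurable
    (ae_of_all _ fun ω => ?_)
  rw [Real.norm_of_nonneg (hg0 ω), Pi.add_apply]
  have := Real.rpow_nonneg (hg0 ω) p
  rcases le_total (g ω) 1 with h | h
  · linarith
  · linarith [Real.self_le_rpow_of_one_le h hp1]

theorem summable_truncated_sq (hp1 : 1 ≤ p) (hp2 : p < 2) (hl : 1 < l) (hlp : l ^ p = 2)
    (hg : Measurable g) (hg0 : ∀ ω, 0 ≤ g ω) (hint : Integrable (fun ω => g ω ^ p) ν) :
    Summable fun k : ℕ => 2 ^ k * ∫ ω, (min (g ω) (l ^ k) / l ^ k) ^ 2 ∂ν := by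
  simpa only [integral_const_mul] using
    summable_integral_truncated_sq hp1 hp2 hl hlp hg hg0 hint

/-- The expected norms of the truncated and centred dyadic partial sums are `o(2 ^ (k / p))`. -/
theorem eventually_integral_norm_sum_centredTrunc_le (hp1 : 1 ≤ p) (hp2 : p < 2) (hq : 0 < q)
    (hl : 1 < l) (hlp : l ^ p = 2) (hX : ∀ i, Measurable (X i)) (hind : iIndepFun X μ)
    (hmean : ∀ i, MeanZero (X i) μ) (hg : Measurable g) (hg0 : ∀ ω, 0 ≤ g ω)
    (hint : Integrable (fun ω => g ω ^ p) ν)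
    (htail : ∀ i t, 0 ≤ t → μ {ω | t < ‖X i ω‖} ≤ ν {ω | t < g ω})
    (hsum : PQTypeSLLN p q X μ) {c : ℝ} (hc : 0 < c) :
    ∀ᶠ k : ℕ in atTop,
      ∫ ω, ‖∑ i ∈ Finset.range (2 ^ k), centredTrunc (l ^ k) X μ i ω‖ ∂μ ≤ 5 * c * l ^ k := by
  have hgi := integrable_of_integrable_rpow hp1 hg hg0 hint
  have hb := (summable_truncated_sq hp1 hp2 hl hlp hg hg0 hint).tendsto_atTop_zero
  have he := tendsto_integral_tailPart hp1 hl hlp hg hg0 hint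
  have hS : ∀ n, Measurable (partialSum X n) := fun n =>
    Finset.measurable_fun_sum _ fun i _ => hX i
  filter_upwards [eventually_exists_measureReal_lt_half (μ := μ) (u := fun n ω => ‖partialSum X n ω‖)
      hq hc (fun n => (hS n).norm) (fun n ω => norm_nonneg _) hsum,
    hb.eventually_lt_const (show (0 : ℝ) < 1 / 16 by norm_num),
    hb.eventually_lt_const (show (0 : ℝ) < c ^ 2 / 16 by positivity),
    he.eventually_lt_const hc] with k ⟨n, hn, hSn⟩ hb1 hb2 hek
  obtain ⟨hn1, hn2⟩ := Finset.mem_Ico.1 hn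
  have hlk : 0 < l ^ k := by positivity
  set M := ∫ ω, (min (g ω) (l ^ k) / l ^ k) ^ 2 ∂ν with hM
  have hM0 : 0 ≤ M := integral_nonneg fun ω => sq_nonneg _
  set D := ∫ ω, tailPart (l ^ k) (g ω) ∂ν with hD
  set U : ℕ → Ω → B := fun n ω => ∑ i ∈ Finset.range n, centredTrunc (l ^ k) X μ i ω with hU
  set a := ∫ ω, ‖U n ω‖ ∂μ with ha
  have hUm : ∀ n, Measurable (U n) := fun n =>
    Finset.measurable_fun_sum _ fun i _ => measurable_centredTrunc hX i
  have hmem : MemLp (fun ω => ‖U n ω‖) 2 μ :=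
    memLp_comp_of_bounded (f := fun x : B => ‖x‖) lipschitzWith_one_norm (hUm n)
      (norm_sum_range_le (norm_centredTrunc_le hlk.le) n) 2
  have hn2' : (n : ℝ) ≤ 2 * 2 ^ k := by
    have : (n : ℝ) ≤ 2 ^ (k + 1) := by exact_mod_cast hn2.le
    rwa [pow_succ, mul_comm] at this
  have h2 : μ.real {ω | ∃ i < 2 ^ (k + 1), l ^ k < ‖X i ω‖} ≤ 1 / 8 := by
    refine (measureReal_exists_norm_gt_le hg hg0 htail hlk _).trans ?_
    push_cast
    rw [pow_succ, mul_comm ((2 : ℝ) ^ k), mul_assoc]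
    linarith
  have h3 : μ.real {ω | c * l ^ k ≤ |‖U n ω‖ - a|} ≤ 1 / 8 := by
    refine (ENNReal.toReal_le_of_le_ofReal (div_nonneg (variance_nonneg _ _) (sq_nonneg _))
      (meas_ge_le_variance_div_sq hmem (by positivity))).trans ?_
    rw [div_le_iff₀ (by positivity)]
    refine (variance_norm_sum_centredTrunc_le hX hind hg hg0 htail hlk n).trans ?_
    calc (n : ℝ) * ((l ^ k) ^ 2 * M) ≤ 2 * 2 ^ k * ((l ^ k) ^ 2 * M) := by gcongr
      _ = 2 * (2 ^ k * M) * (l ^ k) ^ 2 := by ring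
      _ ≤ 2 * (c ^ 2 / 16) * (l ^ k) ^ 2 := by gcongr
      _ = _ := by ring
  -- The three exceptional events have total probability below `1/2 + 1/8 + 1/8 < 1`, so some `ω`
  -- avoids them all. At it the deterministic number `a` can be estimated.
  obtain ⟨ω, hω1, hω2, hω3⟩ : ∃ ω, ‖partialSum X n ω‖ < c * (n : ℝ) ^ (1 / p) ∧
      (¬ ∃ i < 2 ^ (k + 1), l ^ k < ‖X i ω‖) ∧ |‖U n ω‖ - a| < c * l ^ k := by
    by_contra! hcon
    have huniv : Set.univ ⊆ {ω | c * (n : ℝ) ^ (1 / p) ≤ ‖partialSum X n ω‖} ∪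
        ({ω | ∃ i < 2 ^ (k + 1), l ^ k < ‖X i ω‖} ∪ {ω | c * l ^ k ≤ |‖U n ω‖ - a|}) := by
      intro ω _
      by_cases h1 : ‖partialSum X n ω‖ < c * (n : ℝ) ^ (1 / p)
      · by_cases h2 : ∃ i < 2 ^ (k + 1), l ^ k < ‖X i ω‖
        · exact Or.inr (Or.inl h2)
        · exact Or.inr (Or.inr (hcon ω h1 fun i hi => not_lt.1 fun h => h2 ⟨i, hi, h⟩))
      · exact Or.inl (not_lt.1 h1)
    have h4 := measureReal_mono (μ := μ) huniv
    rw [probReal_univ] at h4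
    have h5 := measureReal_union_le (μ := μ) {ω | c * (n : ℝ) ^ (1 / p) ≤ ‖partialSum X n ω‖}
      ({ω | ∃ i < 2 ^ (k + 1), l ^ k < ‖X i ω‖} ∪ {ω | c * l ^ k ≤ |‖U n ω‖ - a|})
    have h6 := measureReal_union_le (μ := μ) {ω | ∃ i < 2 ^ (k + 1), l ^ k < ‖X i ω‖}
      {ω | c * l ^ k ≤ |‖U n ω‖ - a|}
    linarith
  have hmono : ∫ ω, ‖U (2 ^ k) ω‖ ∂μ ≤ a :=
    integral_norm_sum_mono (measurable_centredTrunc hX) (norm_centredTrunc_le hlk.le)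
      (iIndepFun_centredTrunc hind) (integral_centredTrunc hX hlk.le) hn1
  have hclose := norm_partialSum_sub_le hX hmean hg hg0 hgi htail hlk.le hn2.le hω2
  have hD' : ((2 ^ (k + 1) : ℕ) : ℝ) * D ≤ 2 * c * l ^ k := by
    rw [div_mul_eq_mul_div, div_lt_iff₀ hlk] at hek
    push_cast
    rw [pow_succ]
    linarith
  have hnp : (n : ℝ) ^ (1 / p) ≤ 2 * l ^ k := by
    calc (n : ℝ) ^ (1 / p) ≤ ((2 : ℝ) ^ (k + 1)) ^ (1 / p) :=
          Real.rpow_le_rpow (by positivity) (by exact_mod_cast hn2.le) (by positivity)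
      _ = l * l ^ k := by rw [rpow_one_div_pow (by linarith) hl hlp, pow_succ, mul_comm]
      _ ≤ _ := by
        gcongr
        exact le_two_of_rpow_eq_two hp1 hl hlp
  have h7 : ‖U n ω‖ ≤ ‖partialSum X n ω‖ + ‖partialSum X n ω - U n ω‖ := by
    have := norm_sub_norm_le (U n ω) (partialSum X n ω)
    rw [norm_sub_rev] at this
    linarith
  have h8 : c * (n : ℝ) ^ (1 / p) ≤ c * (2 * l ^ k) := by gcongr
  have h9 := (abs_lt.1 hω3).1
  -- The `5 * c` is `2 * c` from the partial sum, `2 * c` from centring and `c` from the deviation.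
  linarith

/-- Almost surely, the largest partial sum in each late dyadic range is small. -/
theorem ae_eventually_norm_partialSum_le (hp1 : 1 ≤ p) (hp2 : p < 2) (hq : 0 < q)
    (hl : 1 < l) (hlp : l ^ p = 2) (hX : ∀ i, Measurable (X i)) (hind : iIndepFun X μ)
    (hmean : ∀ i, MeanZero (X i) μ) (hg : Measurable g) (hg0 : ∀ ω, 0 ≤ g ω)
    (hint : Integrable (fun ω => g ω ^ p) ν)
    (htail : ∀ i t, 0 ≤ t → μ {ω | t < ‖X i ω‖} ≤ ν {ω | t < g ω})
    (hsum : PQTypeSLLN p q X μ) {c : ℝ} (hc : 0 < c) :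
    ∀ᵐ ω ∂μ, ∀ᶠ k : ℕ in atTop, ∀ n ≤ 2 ^ k, ‖partialSum X n ω‖ ≤ 7 * c * l ^ k := by
  have hgi := integrable_of_integrable_rpow hp1 hg hg0 hint
  have hb := summable_truncated_sq hp1 hp2 hl hlp hg hg0 hint
  have he := tendsto_integral_tailPart hp1 hl hlp hg hg0 hint
  set U : ℕ → ℕ → Ω → B := fun k n ω => ∑ i ∈ Finset.range n, centredTrunc (l ^ k) X μ i ω with hU
  set a : ℕ → ℝ := fun k => ∫ ω, ‖U k (2 ^ k) ω‖ ∂μ with ha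
  set E₁ : ℕ → Set Ω := fun k => {ω | ∃ i < 2 ^ k, l ^ k < ‖X i ω‖}
  set E₂ : ℕ → Set Ω := fun k => {ω | ∃ n ≤ 2 ^ k, a k + c * l ^ k ≤ ‖U k n ω‖}
  -- The `1` pays for summands above the truncation level, the `1 / c ^ 2` for Doob's inequality.
  have hbad : ∀ k, μ (E₁ k ∪ E₂ k) ≤ ENNReal.ofReal
      ((1 + 1 / c ^ 2) * (2 ^ k * ∫ ω, (min (g ω) (l ^ k) / l ^ k) ^ 2 ∂ν)) := fun k => by
    have hlk : 0 < l ^ k := by positivity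
    set M := ∫ ω, (min (g ω) (l ^ k) / l ^ k) ^ 2 ∂ν with hM
    have hM0 : 0 ≤ M := integral_nonneg fun ω => sq_nonneg _
    have h1 : μ (E₁ k) ≤ ENNReal.ofReal (2 ^ k * M) := by
      rw [← ofReal_measureReal]
      exact ENNReal.ofReal_le_ofReal
        (by simpa using measureReal_exists_norm_gt_le hg hg0 htail hlk (2 ^ k))
    have h2 : μ (E₂ k) ≤ ENNReal.ofReal (1 / c ^ 2 * (2 ^ k * M)) := by
      refine (measure_exists_norm_sum_ge_le (measurable_centredTrunc hX)
        (norm_centredTrunc_le hlk.le) (iIndepFun_centredTrunc hind)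
        (integral_centredTrunc hX hlk.le) (2 ^ k) (t := c * l ^ k) (by positivity)).trans
        (ENNReal.ofReal_le_ofReal ?_)
      rw [div_le_iff₀ (by positivity)]
      refine (variance_norm_sum_centredTrunc_le hX hind hg hg0 htail hlk _).trans (le_of_eq ?_)
      push_cast
      rw [← hM]
      field_simp
    refine (measure_union_le _ _).trans ((add_le_add h1 h2).trans (le_of_eq ?_))
    rw [← ENNReal.ofReal_add (by positivity) (by positivity)]
    ring_nf
  have hfin : ∑' k, μ (E₁ k ∪ E₂ k) ≠ ⊤ :=
    ne_top_of_le_ne_top (hb.mul_left (1 + 1 / c ^ 2)).tsum_ofReal_ne_top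
      (ENNReal.tsum_le_tsum hbad)
  filter_upwards [ae_eventually_notMem hfin] with ω hω
  filter_upwards [hω, he.eventually_lt_const hc, eventually_integral_norm_sum_centredTrunc_le hp1
    hp2 hq hl hlp hX hind hmean hg hg0 hint htail hsum hc] with k hk hek hak n hn
  have hlk : 0 < l ^ k := by positivity
  have hk1 : ¬ ∃ i < 2 ^ k, l ^ k < ‖X i ω‖ := fun h => hk (Or.inl h)
  have hk2 : ‖U k n ω‖ < a k + c * l ^ k := not_le.1 fun h => hk (Or.inr ⟨n, hn, h⟩)
  have hclose := norm_partialSum_sub_le hX hmean hg hg0 hgi htail hlk.le hn hk1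
  have hD' : ((2 ^ k : ℕ) : ℝ) * ∫ ω, tailPart (l ^ k) (g ω) ∂ν ≤ c * l ^ k := by
    rw [div_mul_eq_mul_div, div_lt_iff₀ hlk] at hek
    push_cast
    exact hek.le
  have h7 := norm_sub_norm_le (partialSum X n ω) (U k n ω)
  -- The `7 * c` is `5 * c` from the mean norm, `c` from the maximal deviation and `c` from
  -- centring.
  linarith

theorem tendsto_inv_rpow_smul {p : ℝ} (hp1 : 1 ≤ p) (hl : 1 < l) (hlp : l ^ p = 2)
    {B : Type*} [NormedAddCommGroup B] [NormedSpace ℝ B] {s : ℕ → B}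
    (h : ∀ m : ℕ, ∀ᶠ k : ℕ in atTop, ∀ n ≤ 2 ^ k, ‖s n‖ ≤ 7 * (1 / ((m : ℝ) + 1)) * l ^ k) :
    Tendsto (fun n : ℕ => ((n : ℝ) ^ (1 / p))⁻¹ • s n) atTop (𝓝 0) := by
  rw [Metric.tendsto_atTop]
  intro ε hε
  -- Here `14 = 7 * 2`: the bound is used at `k + 1` with `2 ^ k ≤ n < 2 ^ (k + 1)`, which costs a
  -- factor `l ≤ 2`.
  obtain ⟨m, hm⟩ := exists_nat_one_div_lt (show 0 < ε / 14 by positivity)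
  obtain ⟨K, hK⟩ := eventually_atTop.1 (h m)
  refine ⟨2 ^ K, fun n hn => ?_⟩
  have hn0 : n ≠ 0 := by
    have : 0 < 2 ^ K := by positivity
    omega
  have hlog : K ≤ Nat.log 2 n := Nat.le_log_of_pow_le one_lt_two hn
  set k := Nat.log 2 n
  have hkn : (2 : ℝ) ^ k ≤ n := by exact_mod_cast Nat.pow_log_le_self 2 hn0
  have hs := hK (k + 1) (by omega) n (Nat.lt_pow_succ_log_self one_lt_two n).le
  have hlk : 0 < l ^ k := by positivity
  have hnp : l ^ k ≤ (n : ℝ) ^ (1 / p) := by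
    rw [← rpow_one_div_pow (by linarith) hl hlp]
    exact Real.rpow_le_rpow (by positivity) hkn (by positivity)
  have hnp0 : 0 < (n : ℝ) ^ (1 / p) := hlk.trans_le hnp
  rw [dist_zero_right, norm_smul, norm_inv, Real.norm_of_nonneg hnp0.le, inv_mul_lt_iff₀ hnp0]
  calc ‖s n‖ ≤ 7 * (1 / ((m : ℝ) + 1)) * l ^ (k + 1) := hs
    _ = 7 * (1 / ((m : ℝ) + 1)) * l * l ^ k := by ring
    _ ≤ 7 * (1 / ((m : ℝ) + 1)) * 2 * l ^ k := by
      gcongr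
      exact le_two_of_rpow_eq_two hp1 hl hlp
    _ < ε * l ^ k := by
      gcongr
      linarith
    _ ≤ ε * (n : ℝ) ^ (1 / p) := by gcongr
    _ = _ := by ring

end StrongLaw

end PQSLLN

theorem mainTheorem6
    {B : Type*} [NormedAddCommGroup B] [NormedSpace ℝ B] [CompleteSpace B]
    [TopologicalSpace.SeparableSpace B] [MeasurableSpace B] [BorelSpace B]
    {F : Type*} [NormedAddCommGroup F] [NormedSpace ℝ F] [CompleteSpace F]
    [TopologicalSpace.SeparableSpace F] [MeasurableSpace F] [BorelSpace F]
    {Ω : Type*} [MeasurableSpace Ω] (μ : Measure Ω) [IsProbabilityMeasure μ]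
    {Ω' : Type*} [MeasurableSpace Ω'] (ν : Measure Ω') [IsProbabilityMeasure ν]
    (p q : ℝ) (hp1 : 1 ≤ p) (hp2 : p < 2) (hq : 0 < q)
    (X : ℕ → Ω → B) (hX : ∀ n, Measurable (X n))
    (hindep : iIndepFun X μ)
    (hmean : ∀ n, PQSLLN.MeanZero (X n) μ)
    (Y : Ω' → F) (hY : Measurable Y)
    (hdom : PQSLLN.StochDominated X μ Y ν)
    (hmoment : Integrable (fun ω => ‖Y ω‖ ^ p) ν)
    (hsymm : q < 1 → ∀ n, PQSLLN.SymmetricRV (X n) μ)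
    (hsum : PQSLLN.PQTypeSLLN p q X μ) :
    PQSLLN.MZSLLN p X μ := by
  have : SecondCountableTopology B := UniformSpace.secondCountable_of_separable B
  have hp0 : 0 < p := by linarith
  have hl : 1 < (2 : ℝ) ^ (1 / p) := Real.one_lt_rpow one_lt_two (by positivity)
  have hlp : ((2 : ℝ) ^ (1 / p)) ^ p = 2 := by
    rw [← Real.rpow_mul zero_le_two, one_div_mul_cancel hp0.ne', Real.rpow_one]
  have h : ∀ᵐ ω ∂μ, ∀ m : ℕ, ∀ᶠ k : ℕ in atTop, ∀ n ≤ 2 ^ k,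
      ‖PQSLLN.partialSum X n ω‖ ≤ 7 * (1 / ((m : ℝ) + 1)) * ((2 : ℝ) ^ (1 / p)) ^ k :=
    ae_all_iff.2 fun m => PQSLLN.ae_eventually_norm_partialSum_le hp1 hp2 hq hl hlp hX hindep hmean
      hY.norm (fun ω => norm_nonneg _) hmoment
      (fun i t ht => (le_iSup (fun n => μ {ω | t < ‖X n ω‖}) i).trans (hdom t ht)) hsum
      (by positivity)
  filter_upwards [h] with ω hω
  exact PQSLLN.tendsto_inv_rpow_smul hp1 hl hlp hω
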